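/- For a two-qubit state $\rho$ (a density matrix on $\mathbb{C}^2\otimes\mathbb{C}^2$) and $i\in\{x,z\}$, let $S_{ii}^{(q)}(\rho)=\frac{1}{q-1}\bigl(1-\sum_{j} p_j^q\bigr)$ be the Tsallis-$q$ entropy of the four outcome probabilities $p_j$ of the local measurement $\sigma_i\otimes\sigma_i$ in the state $\rho$. For real $q,\tilde q\ge 2$ let $R=\{(S_{xx}^{(\tilde q)}(\rho),S_{zz}^{(q)}(\rho)) : \rho \text{ a two-qubit state}\}$, and let the lower boundary of $R$ be the set of all $(r,y)\in R$ such that $y\le y'$ for all $(r,y')\in R$. For $1\le t<\infty$ let $|\psi_t\rangle=\frac{1}{\sqrt{3+t^2}}\,(t|00\rangle+|01\rangle+|10\rangle+|11\rangle)$, and let $|\psi_\infty\rangle=|00\rangle$; then $|\psi_t\rangle\langle\psi_t|\to|\psi_\infty\rangle\langle\psi_\infty|$ as $t\to\infty$. Then, for all real $q,\tilde q\ge 2$, the lower boundary of $R$ is exactly $$\bigl\{\bigl(S_{xx}^{(\tilde q)}(\psi_t),\,S_{zz}^{(q)}(\psi_t)\bigr) : 1\le t\le\infty\bigr\}.$$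 Moreover, for every two-qubit state $\rho$ one has $S_{xx}^{(\tilde q)}(\rho)\le S_{xx}^{(\tilde q)}(\psi_\infty)$, there is exactly one $t\in[1,\infty]$ with $S_{xx}^{(\tilde q)}(\psi_t)=S_{xx}^{(\tilde q)}(\rho)$ (and $t=\infty$ if and only if $S_{xx}^{(\tilde q)}(\rho)=S_{xx}^{(\tilde q)}(\psi_\infty)$), and for this $t$ one has $S_{zz}^{(q)}(\psi_t)\le S_{zz}^{(q)}(\rho)$. -/

import Mathlib

open Matrix
open scoped Kronecker ComplexOrder

noncomputable section

namespace ScrambledQubits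

/-- Operators on one qubit, in the computational basis `|0⟩, |1⟩`. -/
abbrev QubitOp := Matrix (Fin 2) (Fin 2) ℂ

/-- Operators on two qubits; the index `(i, j)` stands for `|ij⟩`. -/
abbrev TwoQubitOp := Matrix (Fin 2 × Fin 2) (Fin 2 × Fin 2) ℂ

/-- Two-qubit vectors, in coordinates with respect to `|00⟩, |01⟩, |10⟩, |11⟩`. -/
abbrev TwoQubitVec := Fin 2 × Fin 2 → ℂ

/-- A two-qubit state, pure or mixed: a density matrix. -/
structure TwoQubitState where
  op : TwoQubitOp
  posSemidef : op.PosSemidef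
  trace_eq_one : op.trace = 1

/-- The pure state `|v⟩⟨v|` of a unit vector `v`. -/
def pureState (v : TwoQubitVec) (hv : v ⬝ᵥ star v = 1) : TwoQubitState where
  op := vecMulVec v (star v)
  posSemidef := posSemidef_vecMulVec_self_star v
  trace_eq_one := by rw [trace_vecMulVec, hv]

/-- The Pauli matrix `σ_x`. -/
def sigmaX : QubitOp := !![0, 1; 1, 0]

/-- The Pauli matrix `σ_z`. -/
def sigmaZ : QubitOp := !![1, 0; 0, -1]

/-- The spectral projector of a dichotomic observable `A` (with `A² = 1`) for the outcome
`(-1)^a`: outcome `+1` for `a = 0` and `-1` for `a = 1`. -/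
def outcomeProj (A : QubitOp) (a : Fin 2) : QubitOp :=
  (1 / 2 : ℂ) • (1 + (-1 : ℂ) ^ (a : ℕ) • A)

/-- The probability (Born rule) that the local measurement `A ⊗ A` in the state `ρ` gives the
outcomes `(-1)^a` on the first and `(-1)^b` on the second qubit, where `ab = (a, b)`. -/
def outcomeProb (A : QubitOp) (ρ : TwoQubitState) (ab : Fin 2 × Fin 2) : ℝ :=
  (ρ.op * (outcomeProj A ab.1 ⊗ₖ outcomeProj A ab.2)).trace.re

/-- The Tsallis-`q` entropy of a finite probability vector. -/
def tsallis {ι : Type*} [Fintype ι] (q : ℝ) (p : ι → ℝ) : ℝ :=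
  (1 / (q - 1)) * (1 - ∑ j, p j ^ q)

/-- `S_xx^{(q)}`: the Tsallis-`q` entropy of the outcomes of `σ_x ⊗ σ_x`. -/
def Sxx (q : ℝ) (ρ : TwoQubitState) : ℝ := tsallis q (outcomeProb sigmaX ρ)

/-- `S_zz^{(q)}`: the Tsallis-`q` entropy of the outcomes of `σ_z ⊗ σ_z`. -/
def Szz (q : ℝ) (ρ : TwoQubitState) : ℝ := tsallis q (outcomeProb sigmaZ ρ)

/-- The point of the state `ρ` in the `(S_xx^{(q')}, S_zz^{(q)})`-plot. -/
def entropyPoint (q' q : ℝ) (ρ : TwoQubitState) : ℝ × ℝ := (Sxx q' ρ, Szz q ρ)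

/-- The region of all pairs `(S_xx^{(q')}, S_zz^{(q)})` achieved by two-qubit states. -/
def entropyRegion (q' q : ℝ) : Set (ℝ × ℝ) := Set.range (entropyPoint q' q)

/-- The lower boundary of a plane region: its lowest point on each vertical line on which
there is one. -/
def lowerBoundary (R : Set (ℝ × ℝ)) : Set (ℝ × ℝ) :=
  {P | P ∈ R ∧ ∀ y, (P.1, y) ∈ R → P.2 ≤ y}

/-- The computational basis vector `|ij⟩`. -/
def ket (i j : Fin 2) : TwoQubitVec := Pi.single (i, j) 1

/-- The vector `(t|00⟩ + |01⟩ + |10⟩ + |11⟩) / √(3 + t²)`. -/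
def psiVec (t : ℝ) : TwoQubitVec :=
  (1 / (Real.sqrt (3 + t ^ 2) : ℂ)) • ((t : ℂ) • ket 0 0 + ket 0 1 + ket 1 0 + ket 1 1)

theorem psiVec_unit (t : ℝ) : psiVec t ⬝ᵥ star (psiVec t) = 1 := by
  have h0 : (0 : ℝ) < 3 + t ^ 2 := by positivity
  have h1 : ((Real.sqrt (3 + t ^ 2) : ℝ) : ℂ) ^ 2 = 3 + (t : ℂ) ^ 2 := by
    rw [← Complex.ofReal_pow, Real.sq_sqrt h0.le]; push_cast; ring
  have h2 : ((Real.sqrt (3 + t ^ 2) : ℝ) : ℂ) ≠ 0 :=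
    Complex.ofReal_ne_zero.mpr (Real.sqrt_pos.mpr h0).ne'
  simp [psiVec, ket, dotProduct, Fintype.sum_prod_type, Pi.single_apply]
  field_simp
  rw [h1]; ring

theorem ket_unit (i j : Fin 2) : ket i j ⬝ᵥ star (ket i j) = 1 := by
  simp [ket]

/-- The pure state `|ψ_t⟩⟨ψ_t|`. -/
def psi (t : ℝ) : TwoQubitState := pureState (psiVec t) (psiVec_unit t)

/-- The pure state `|00⟩⟨00|`, the limit of `|ψ_t⟩⟨ψ_t|` as `t → ∞`. -/
def psiInfty : TwoQubitState := pureState (ket 0 0) (ket_unit 0 0)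

end ScrambledQubits

end

namespace ScrambledQubits

/-! ### Outcome probabilities -/

/-! Entropy decreases as the power sum of the outcome distribution grows, so the task is to bound
the `σ_z` power sum given the `σ_x` one. Two extremal facts meet at the same distributions, the
peaked ones `(x, (1-x)/3, (1-x)/3, (1-x)/3)`, and `ψ_t` is peaked in both bases.

Among distributions with a given 2-norm, the peaked one has the largest `q`-power sum for `q ≥ 2`
(`sum_rpow_le_peakedPowSum`), and this sum increases with the peak. It therefore suffices to trade
the two 2-norms, written `(1 + 3r²)/4` and `(1 + 3w²)/4`, against each other.

That trade is a family of linear bounds in `r` and `w` (`uncertainty_relation`). Each comes from an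
operator inequality for a combination of Pauli observables, whose worst case with prescribed
coefficient norms is `4(a|00⟩⟨00| + b|++⟩⟨++|) - (a+b)` (`posSemidef_sub_pauliComb`). Since
`|⟨00|++⟩|² = 1/4`, the equation `3ab = 4(a+b-1)` says that `a|00⟩⟨00| + b|++⟩⟨++|` has eigenvalue
1. The bounds are attained by the vectors `ψ_t` in the span of `|00⟩` and `|++⟩`. -/

open scoped MatrixOrder in
theorem trace_mul_re_nonneg {ι : Type*} [Fintype ι] [DecidableEq ι] {A B : Matrix ι ι ℂ}
    (hA : A.PosSemidef) (hB : B.PosSemidef) : 0 ≤ (A * B).trace.re := by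
  obtain ⟨C, rfl⟩ : ∃ C : Matrix ι ι ℂ, A = Cᴴ * C := by
    exact CStarAlgebra.nonneg_iff_eq_star_mul_self.mp hA.nonneg
  rw [Matrix.mul_assoc, Matrix.trace_mul_comm]
  exact (Complex.nonneg_iff.mp (hB.mul_mul_conjTranspose_same C).trace_nonneg).1

theorem posSemidef_outcomeProj {A : QubitOp} (hA : A.IsHermitian) (hA2 : A * A = 1) (a : Fin 2) :
    (outcomeProj A a).PosSemidef := by
  have hs : ((-1 : ℂ) ^ (a : ℕ)) * (-1) ^ (a : ℕ) = 1 := by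
    rw [← mul_pow]; simp
  have hh : (outcomeProj A a)ᴴ = outcomeProj A a := by
    simp [outcomeProj, Matrix.conjTranspose_smul, Matrix.conjTranspose_add, hA.eq]
  have hsq : outcomeProj A a = (outcomeProj A a)ᴴ * outcomeProj A a := by
    rw [hh]
    simp only [outcomeProj, mul_add, add_mul, one_mul, mul_one, smul_mul_assoc,
      mul_smul_comm, hA2, smul_smul]
    ext i j
    simp only [Matrix.smul_apply, Matrix.add_apply, smul_eq_mul]
    linear_combination (-1 / 4 : ℂ) * (1 : QubitOp) i j * hs
  rw [hsq]
  exact posSemidef_conjTranspose_mul_self _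

theorem sum_outcomeProj (A : QubitOp) : ∑ a, outcomeProj A a = 1 := by
  ext i j
  simp [outcomeProj, Fin.sum_univ_two]
  ring

theorem outcomeProb_nonneg {A : QubitOp} (hA : A.IsHermitian) (hA2 : A * A = 1)
    (ρ : TwoQubitState) (ab : Fin 2 × Fin 2) : 0 ≤ outcomeProb A ρ ab :=
  trace_mul_re_nonneg ρ.posSemidef
    ((posSemidef_outcomeProj hA hA2 _).kronecker (posSemidef_outcomeProj hA hA2 _))

theorem sum_outcomeProb (A : QubitOp) (ρ : TwoQubitState) : ∑ ab, outcomeProb A ρ ab = 1 := by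
  have h : ∑ ab : Fin 2 × Fin 2, outcomeProj A ab.1 ⊗ₖ outcomeProj A ab.2 = 1 := by
    rw [← Matrix.one_kronecker_one, ← sum_outcomeProj A]
    ext i j
    simp [Fintype.sum_prod_type, Matrix.sum_apply]
    ring
  simp only [outcomeProb]
  rw [← Complex.re_sum, ← Matrix.trace_sum, ← Matrix.mul_sum, h, mul_one, ρ.trace_eq_one]
  simp

theorem sigmaX_isHermitian : sigmaX.IsHermitian := by
  ext i j; fin_cases i <;> fin_cases j <;> simp [sigmaX]

theorem sigmaZ_isHermitian : sigmaZ.IsHermitian := by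
  ext i j; fin_cases i <;> fin_cases j <;> simp [sigmaZ]

theorem sigmaX_mul_self : sigmaX * sigmaX = 1 := by
  ext i j; fin_cases i <;> fin_cases j <;> simp [sigmaX]

theorem sigmaZ_mul_self : sigmaZ * sigmaZ = 1 := by
  ext i j; fin_cases i <;> fin_cases j <;> simp [sigmaZ]

theorem outcomeProb_sigmaZ (ρ : TwoQubitState) (i j : Fin 2) :
    outcomeProb sigmaZ ρ (i, j) = (ρ.op (i, j) (i, j)).re := by
  fin_cases i <;> fin_cases j <;>
    simp [outcomeProb, sigmaZ, outcomeProj, Matrix.trace, Matrix.mul_apply,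
      Fintype.sum_prod_type, Matrix.one_apply] <;> norm_num

theorem outcomeProb_sigmaX (ρ : TwoQubitState) (i j : Fin 2) :
    outcomeProb sigmaX ρ (i, j) = (1 / 4) * ∑ k : Fin 2, ∑ l : Fin 2, ∑ k' : Fin 2, ∑ l' : Fin 2,
      (-1 : ℝ) ^ ((i : ℕ) * (k + k') + j * (l + l')) * (ρ.op (k, l) (k', l')).re := by
  fin_cases i <;> fin_cases j <;>
    simp [outcomeProb, sigmaX, outcomeProj, Matrix.trace, Matrix.mul_apply,
      Fintype.sum_prod_type, Matrix.one_apply, Fin.sum_univ_two] <;> ring_nf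

/-! ### A bound on the spectrum of combinations of Pauli observables -/

/-- The observable `n₀ σ_z ⊗ 1 + n₁ 1 ⊗ σ_z + n₂ σ_z ⊗ σ_z + m₀ σ_x ⊗ 1 + m₁ 1 ⊗ σ_x + m₂ σ_x ⊗ σ_x`,
in the basis `|00⟩, |01⟩, |10⟩, |11⟩`. -/
noncomputable def pauliComb (n m : Fin 3 → ℝ) : Matrix (Fin 4) (Fin 4) ℂ :=
  !![(n 0 + n 1 + n 2 : ℂ), m 1, m 0, m 2;
     m 1, n 0 - n 1 - n 2, m 2, m 0;
     m 0, m 2, -n 0 + n 1 - n 2, m 1;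
     m 2, m 0, m 1, -n 0 - n 1 + n 2]

theorem pauliComb_isHermitian (n m : Fin 3 → ℝ) : (pauliComb n m).IsHermitian := by
  ext i j; fin_cases i <;> fin_cases j <;> simp [pauliComb]

theorem det_sub_pauliComb (n m : Fin 3 → ℝ) (c : ℝ) :
    ((c : ℂ) • (1 : Matrix (Fin 4) (Fin 4) ℂ) - pauliComb n m).det =
      (((c ^ 2 - (∑ k, n k ^ 2 + ∑ k, m k ^ 2)) ^ 2
        - 8 * c * (n 0 * n 1 * n 2 + m 0 * m 1 * m 2)
        - 2 * ((∑ k, n k ^ 2) ^ 2 + (∑ k, m k ^ 2) ^ 2)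
        + 2 * ((n 0 ^ 2 - m 1 ^ 2) ^ 2 + (n 1 ^ 2 - m 0 ^ 2) ^ 2
          + (n 2 ^ 2 - m 2 ^ 2) ^ 2) : ℝ) : ℂ) := by
  simp [pauliComb, Matrix.det_succ_row_zero, Fin.sum_univ_succ, Fin.succAbove, Matrix.one_apply]
  ring

theorem trace_mul_pauliComb (ρ : TwoQubitState) (n m : Fin 3 → ℝ) :
    (ρ.op * (pauliComb n m).submatrix finProdFinEquiv finProdFinEquiv).trace.re =
      n 0 * (outcomeProb sigmaZ ρ (0, 0) + outcomeProb sigmaZ ρ (0, 1)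
        - outcomeProb sigmaZ ρ (1, 0) - outcomeProb sigmaZ ρ (1, 1))
      + n 1 * (outcomeProb sigmaZ ρ (0, 0) - outcomeProb sigmaZ ρ (0, 1)
        + outcomeProb sigmaZ ρ (1, 0) - outcomeProb sigmaZ ρ (1, 1))
      + n 2 * (outcomeProb sigmaZ ρ (0, 0) - outcomeProb sigmaZ ρ (0, 1)
        - outcomeProb sigmaZ ρ (1, 0) + outcomeProb sigmaZ ρ (1, 1))
      + m 0 * (outcomeProb sigmaX ρ (0, 0) + outcomeProb sigmaX ρ (0, 1)
        - outcomeProb sigmaX ρ (1, 0) - outcomeProb sigmaX ρ (1, 1))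
      + m 1 * (outcomeProb sigmaX ρ (0, 0) - outcomeProb sigmaX ρ (0, 1)
        + outcomeProb sigmaX ρ (1, 0) - outcomeProb sigmaX ρ (1, 1))
      + m 2 * (outcomeProb sigmaX ρ (0, 0) - outcomeProb sigmaX ρ (0, 1)
        - outcomeProb sigmaX ρ (1, 0) + outcomeProb sigmaX ρ (1, 1)) := by
  have e00 : finProdFinEquiv ((0 : Fin 2), (0 : Fin 2)) = (0 : Fin 4) := rfl
  have e01 : finProdFinEquiv ((0 : Fin 2), (1 : Fin 2)) = (1 : Fin 4) := rfl
  have e10 : finProdFinEquiv ((1 : Fin 2), (0 : Fin 2)) = (2 : Fin 4) := rfl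
  have e11 : finProdFinEquiv ((1 : Fin 2), (1 : Fin 2)) = (3 : Fin 4) := rfl
  simp only [outcomeProb_sigmaX, outcomeProb_sigmaZ, Matrix.trace, Matrix.mul_apply,
    Fintype.sum_prod_type, Fin.sum_univ_two, Matrix.diag_apply, Matrix.submatrix_apply,
    e00, e01, e10, e11]
  simp [pauliComb]
  ring

/-- A negative eigenvalue `-c` would make `c • 1 + A` singular. Positivity thus reduces to the sign
of an explicit characteristic polynomial. -/
theorem posSemidef_of_det_add_ne_zero {ι : Type*} [Fintype ι] [DecidableEq ι] {A : Matrix ι ι ℂ}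
    (hA : A.IsHermitian) (h : ∀ c : ℝ, 0 < c → ((c : ℂ) • (1 : Matrix ι ι ℂ) + A).det ≠ 0) :
    A.PosSemidef := by
  rw [hA.posSemidef_iff_eigenvalues_nonneg]
  intro i
  by_contra hi
  simp only [Pi.zero_apply, not_le] at hi
  refine h (-hA.eigenvalues i) (by linarith) (Matrix.exists_mulVec_eq_zero_iff.mp
    ⟨(hA.eigenvectorBasis i).ofLp, ?_, ?_⟩)
  · intro h0
    exact hA.eigenvectorBasis.toBasis.ne_zero i (by simpa using h0)
  · rw [Matrix.add_mulVec, hA.mulVec_eigenvectorBasis, Matrix.smul_mulVec, Matrix.one_mulVec]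
    ext j
    simp

/-- AM-GM for the three squares; passing to squares makes the signs of the `x k` irrelevant. -/
theorem mul_mul_le_cube {x : Fin 3 → ℝ} {c : ℝ} (hc : 0 ≤ c) (h : ∑ k, x k ^ 2 = 3 * c ^ 2) :
    x 0 * x 1 * x 2 ≤ c ^ 3 := by
  rw [Fin.sum_univ_three] at h
  have key : (x 0 * x 1 * x 2) ^ 2 ≤ (c ^ 3) ^ 2 := by
    have h0 := sq_nonneg (x 0)
    have h1 := sq_nonneg (x 1)
    have h2 := sq_nonneg (x 2)
    have h3 : c ^ 2 = (x 0 ^ 2 + x 1 ^ 2 + x 2 ^ 2) / 3 := by linarith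
    have : (c ^ 3) ^ 2 = (c ^ 2) ^ 3 := by ring
    rw [this, h3, mul_pow, mul_pow]
    generalize x 0 ^ 2 = a at *
    generalize x 1 ^ 2 = b at *
    generalize x 2 ^ 2 = d at *
    nlinarith [mul_nonneg h0 (sq_nonneg (b - d)), mul_nonneg h1 (sq_nonneg (a - d)),
      mul_nonneg h2 (sq_nonneg (a - b)), mul_nonneg h0 (sq_nonneg (a - b)),
      mul_nonneg h0 (sq_nonneg (a - d)), mul_nonneg h1 (sq_nonneg (a - b)),
      mul_nonneg h1 (sq_nonneg (b - d)), mul_nonneg h2 (sq_nonneg (a - d)),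
      mul_nonneg h2 (sq_nonneg (b - d))]
  exact le_of_sq_le_sq key (by positivity)

/-- If the coefficient vectors have norms `√3 a` and `√3 b`, then `pauliComb n m` is at
most `4 - (a + b)` as soon as `a` and `b` satisfy the equation that makes this the largest eigenvalue for
`n = (a, a, a)` and `m = (b, b, b)`. -/
theorem posSemidef_sub_pauliComb {n m : Fin 3 → ℝ} {a b : ℝ} (ha : 0 ≤ a) (hb : 0 ≤ b)
    (hab : a + b ≤ 2) (hrel : 3 * a * b = 4 * (a + b - 1))
    (hn : ∑ k, n k ^ 2 = 3 * a ^ 2) (hm : ∑ k, m k ^ 2 = 3 * b ^ 2) :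
    (((4 - (a + b) : ℝ) : ℂ) • (1 : Matrix (Fin 4) (Fin 4) ℂ) - pauliComb n m).PosSemidef := by
  apply posSemidef_of_det_add_ne_zero
  · refine Matrix.IsHermitian.sub ?_ (pauliComb_isHermitian n m)
    simp [Matrix.IsHermitian, Matrix.conjTranspose_smul]
  intro c hc
  rw [← add_sub_assoc, ← add_smul, ← Complex.ofReal_add, det_sub_pauliComb, Complex.ofReal_ne_zero]
  apply ne_of_gt
  have hN := mul_mul_le_cube ha hn
  have hM := mul_mul_le_cube hb hm
  rw [hn, hm]
  rw [Fin.sum_univ_three] at hn hm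
  set l : ℝ := c + (4 - (a + b)) with hl
  -- Cauchy-Schwarz. Together with AM-GM for the two products, it shows that the determinant is
  -- smallest when all `n k = a` and all `m k = b`.
  have hCS : 3 * (a ^ 2 - b ^ 2) ^ 2 ≤ (n 0 ^ 2 - m 1 ^ 2) ^ 2 + (n 1 ^ 2 - m 0 ^ 2) ^ 2
      + (n 2 ^ 2 - m 2 ^ 2) ^ 2 := by
    have e : 3 * (a ^ 2 - b ^ 2) = (n 0 ^ 2 - m 1 ^ 2) + (n 1 ^ 2 - m 0 ^ 2)
      + (n 2 ^ 2 - m 2 ^ 2) := by linarith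
    have e2 : 3 * (a ^ 2 - b ^ 2) ^ 2 = (3 * (a ^ 2 - b ^ 2)) ^ 2 / 3 := by ring
    rw [e2, e]
    generalize n 0 ^ 2 - m 1 ^ 2 = u
    generalize n 1 ^ 2 - m 0 ^ 2 = v
    generalize n 2 ^ 2 - m 2 ^ 2 = w
    nlinarith [sq_nonneg (u - v), sq_nonneg (v - w), sq_nonneg (u - w)]
  have hlN : 8 * l * (n 0 * n 1 * n 2 + m 0 * m 1 * m 2) ≤ 8 * l * (a ^ 3 + b ^ 3) :=
    mul_le_mul_of_nonneg_left (by linarith) (by linarith)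
  -- The extremal determinant. Its double root `-(a+b)` belongs to the complement of the span of
  -- `|00⟩` and `|++⟩`; on that span `hrel` makes the roots `4 - (a+b)` and `3(a+b) - 4`, and `a + b
  -- ≤ 2` makes the former the larger.
  have hfac : (l ^ 2 - (3 * a ^ 2 + 3 * b ^ 2)) ^ 2 - 8 * l * (a ^ 3 + b ^ 3)
      - 2 * ((3 * a ^ 2) ^ 2 + (3 * b ^ 2) ^ 2) + 6 * (a ^ 2 - b ^ 2) ^ 2
      = c * (l - 3 * (a + b) + 4) * (l + a + b) ^ 2 := by
    have : c = l - 4 + (a + b) := by linarith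
    rw [this]
    linear_combination (4 * (l + a + b) ^ 2) * hrel
  have hpos : 0 < c * (l - 3 * (a + b) + 4) * (l + a + b) ^ 2 := by
    have h1 : 0 < l - 3 * (a + b) + 4 := by linarith
    have h2 : 0 < l + a + b := by linarith
    positivity
  linarith

/-! ### The uncertainty relation for the 2-norms of the outcome distributions -/

theorem exists_sum_mul_eq {v : Fin 3 → ℝ} {r : ℝ} (h : ∑ k, v k ^ 2 = 3 * r ^ 2) :
    ∃ u : Fin 3 → ℝ, ∑ k, u k ^ 2 = 3 ∧ ∑ k, u k * v k = 3 * r := by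
  by_cases hr : r = 0
  · refine ⟨fun _ => 1, by simp, ?_⟩
    subst hr
    have hv : ∀ k, v k = 0 := by
      have := (Finset.sum_eq_zero_iff_of_nonneg (fun k _ => sq_nonneg (v k))).mp (by simpa using h)
      intro k
      simpa using this k (Finset.mem_univ k)
    simp [hv]
  · refine ⟨fun k => v k / r, ?_, ?_⟩
    · simp only [div_pow]
      rw [← Finset.sum_div, h]
      field_simp
    · have : ∀ k, v k / r * v k = v k ^ 2 / r := fun k => by ring
      simp only [this]
      rw [← Finset.sum_div, h]
      field_simp

theorem uncertainty_relation (ρ : TwoQubitState) {r w a b : ℝ}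
    (hr : ∑ j, outcomeProb sigmaZ ρ j ^ 2 = (1 + 3 * r ^ 2) / 4)
    (hw : ∑ j, outcomeProb sigmaX ρ j ^ 2 = (1 + 3 * w ^ 2) / 4)
    (ha : 0 ≤ a) (hb : 0 ≤ b) (hab : a + b ≤ 2) (hrel : 3 * a * b = 4 * (a + b - 1)) :
    a * (1 + 3 * r) + b * (1 + 3 * w) ≤ 4 := by
  have sZ := sum_outcomeProb sigmaZ ρ
  have sX := sum_outcomeProb sigmaX ρ
  have tr := trace_mul_pauliComb ρ
  simp only [Fintype.sum_prod_type, Fin.sum_univ_two] at hr hw sZ sX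
  generalize outcomeProb sigmaZ ρ = z at *
  generalize outcomeProb sigmaX ρ = x at *
  have key : ∀ p : Fin 2 × Fin 2 → ℝ, ∀ s : ℝ,
      p (0, 0) + p (0, 1) + (p (1, 0) + p (1, 1)) = 1 →
      p (0, 0) ^ 2 + p (0, 1) ^ 2 + (p (1, 0) ^ 2 + p (1, 1) ^ 2) = (1 + 3 * s ^ 2) / 4 →
      ∃ u : Fin 3 → ℝ, ∑ k, u k ^ 2 = 3 ∧
        u 0 * (p (0, 0) + p (0, 1) - p (1, 0) - p (1, 1))
        + u 1 * (p (0, 0) - p (0, 1) + p (1, 0) - p (1, 1))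
        + u 2 * (p (0, 0) - p (0, 1) - p (1, 0) + p (1, 1)) = 3 * s := by
    intro p s h1 h2
    -- Parseval for the sign characters: four times the sum of the squares is 1 plus the squared
    -- norm of the three expectation values. That norm is `√3 |s|`, and `u` is aligned with the
    -- vector.
    obtain ⟨u, hu, huv⟩ := exists_sum_mul_eq (r := s)
      (v := ![p (0, 0) + p (0, 1) - p (1, 0) - p (1, 1), p (0, 0) - p (0, 1) + p (1, 0) - p (1, 1),
        p (0, 0) - p (0, 1) - p (1, 0) + p (1, 1)]) (by
        simp [Fin.sum_univ_three]
        linear_combination 4 * h2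
          - (p (0, 0) + p (0, 1) + (p (1, 0) + p (1, 1)) + 1) * h1)
    exact ⟨u, hu, by simpa [Fin.sum_univ_three] using huv⟩
  obtain ⟨u, hu, hu'⟩ := key z r sZ hr
  obtain ⟨v, hv, hv'⟩ := key x w sX hw
  have hpsd := posSemidef_sub_pauliComb (n := a • u) (m := b • v) ha hb hab hrel
    (by simp [mul_pow, ← Finset.mul_sum, hu]; ring) (by simp [mul_pow, ← Finset.mul_sum, hv]; ring)
  have hnn := trace_mul_re_nonneg ρ.posSemidef (hpsd.submatrix finProdFinEquiv)
  rw [Matrix.submatrix_sub, Matrix.submatrix_smul] at hnn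
  simp only [Pi.sub_apply, Pi.smul_apply, Matrix.submatrix_one_equiv, mul_sub, mul_smul_comm,
    mul_one, Matrix.trace_sub, Matrix.trace_smul, ρ.trace_eq_one, Complex.sub_re, tr, smul_eq_mul,
    Complex.ofReal_re] at hnn
  have : a * (3 * r) + b * (3 * w) ≤ 4 - (a + b) := by
    rw [← hu', ← hv']
    linarith
  linarith

/-! ### Power sums of probability vectors with given 2-norm -/

/-- The parabola is tangent to `x ^ q` at `b` and meets it again at `a`, which fixes `C`. The
difference `g` has convex derivative because `q - 1 ≥ 1`; this derivative vanishes at `b` and, by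
Rolle, at some `ξ` between `b` and `a`. Hence `g` rises up to `b`, falls until `ξ` and rises to `a`,
with value 0 at `b` and `a`. -/
theorem rpow_le_parabola {q a b : ℝ} (hq : 2 ≤ q) (hb : 0 ≤ b) (hba : b < a) :
    ∃ A B C : ℝ, (∀ x, 0 ≤ x → x ≤ a → x ^ q ≤ A + B * x + C * x ^ 2) ∧
      a ^ q = A + B * a + C * a ^ 2 ∧ b ^ q = A + B * b + C * b ^ 2 := by
  have hab : a - b ≠ 0 := by linarith
  set C : ℝ := (a ^ q - b ^ q - q * b ^ (q - 1) * (a - b)) / (a - b) ^ 2 with hC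
  set g : ℝ → ℝ := fun x => x ^ q - (b ^ q + q * b ^ (q - 1) * (x - b) + C * (x - b) ^ 2) with hg
  set g' : ℝ → ℝ := fun x => q * x ^ (q - 1) - (q * b ^ (q - 1) + 2 * C * (x - b)) with hg'
  have hderiv : ∀ x, HasDerivAt g (g' x) x := by
    intro x
    have h1 := Real.hasDerivAt_rpow_const (x := x) (p := q) (Or.inr (by linarith))
    have h2 := (hasDerivAt_id x).sub_const b
    refine (h1.sub (((h2.const_mul (q * b ^ (q - 1))).const_add (b ^ q)).add
      ((h2.pow 2).const_mul C))).congr_deriv ?_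
    simp [hg']
    ring
  have hcont : Continuous g := continuous_iff_continuousAt.mpr fun x => (hderiv x).continuousAt
  have hconv : ConvexOn ℝ (Set.Ici 0) g' := by
    have h1 : ConvexOn ℝ (Set.Ici (0 : ℝ)) fun x : ℝ => q * x ^ (q - 1) :=
      (convexOn_rpow (by linarith)).smul (by linarith)
    refine h1.sub ⟨convex_Ici 0, ?_⟩
    intro x _ y _ s t _ _ hst
    simp only [smul_eq_mul]
    apply le_of_eq
    linear_combination (q * b ^ (q - 1) - 2 * C * b) * hst
  have gb : g b = 0 := by simp [hg]
  have ga : g a = 0 := by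
    simp only [hg, hC]
    field_simp
    ring
  have dgb : g' b = 0 := by simp [hg']
  obtain ⟨ξ, ⟨hbξ, hξa⟩, dgξ⟩ := exists_hasDerivAt_eq_zero hba hcont.continuousOn (gb.trans ga.symm)
    fun x _ => hderiv x
  have hgle : ∀ x, 0 ≤ x → x ≤ a → g x ≤ 0 := by
    intro x hx hxa
    rcases le_total x b with hxb | hbx
    · have hmono : MonotoneOn g (Set.Icc 0 b) := by
        refine monotoneOn_of_deriv_nonneg (convex_Icc 0 b) hcont.continuousOn
          (fun y _ => (hderiv y).differentiableAt.differentiableWithinAt) fun y hy => ?_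
        rw [interior_Icc] at hy
        rw [(hderiv y).deriv]
        have := hconv.slope_mono_adjacent (Set.mem_Ici.mpr hy.1.le)
          (Set.mem_Ici.mpr (hb.trans hbξ.le)) hy.2 hbξ
        rw [dgb, dgξ, sub_zero, zero_div, div_le_iff₀ (by linarith [hy.2])] at this
        linarith
      exact (hmono ⟨hx, hxb⟩ ⟨hb, le_rfl⟩ hxb).trans gb.le
    rcases le_total x ξ with hxξ | hξx
    · have hanti : AntitoneOn g (Set.Icc b ξ) := by
        refine antitoneOn_of_deriv_nonpos (convex_Icc b ξ) hcont.continuousOn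
          (fun y _ => (hderiv y).differentiableAt.differentiableWithinAt) fun y hy => ?_
        rw [interior_Icc] at hy
        rw [(hderiv y).deriv]
        have := hconv.slope_mono_adjacent (Set.mem_Ici.mpr hb)
          (Set.mem_Ici.mpr (hb.trans hbξ.le)) hy.1 hy.2
        rw [dgb, dgξ] at this
        by_contra hpos
        rw [not_le] at hpos
        have h1 : 0 < (g' y - 0) / (y - b) := div_pos (by linarith) (by linarith [hy.1])
        have h2 : (0 - g' y) / (ξ - y) < 0 :=
          div_neg_of_neg_of_pos (by linarith) (by linarith [hy.2])
        linarith
      exact (hanti ⟨le_rfl, hbξ.le⟩ ⟨hbx, hxξ⟩ hbx).trans gb.le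
    · have hmono : MonotoneOn g (Set.Icc ξ a) := by
        refine monotoneOn_of_deriv_nonneg (convex_Icc ξ a) hcont.continuousOn
          (fun y _ => (hderiv y).differentiableAt.differentiableWithinAt) fun y hy => ?_
        rw [interior_Icc] at hy
        rw [(hderiv y).deriv]
        have := hconv.slope_mono_adjacent (Set.mem_Ici.mpr hb)
          (Set.mem_Ici.mpr (hb.trans (hbξ.trans hy.1).le)) hbξ hy.1
        rw [dgb, dgξ, sub_zero, sub_zero, zero_div, le_div_iff₀ (by linarith [hy.1])] at this
        linarith
      exact (hmono ⟨hξx, hxa⟩ ⟨hξa.le, le_rfl⟩ hxa).trans ga.le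
  refine ⟨b ^ q - q * b ^ (q - 1) * b + C * b ^ 2, q * b ^ (q - 1) - 2 * C * b, C, ?_, ?_, ?_⟩
  · intro x hx hxa
    have := hgle x hx hxa
    simp only [hg] at this
    linarith
  · simp only [hg] at ga
    linarith
  · ring

/-- The power sum of the probability vector `(a, (1 - a) / 3, (1 - a) / 3, (1 - a) / 3)`. -/
noncomputable def peakedPowSum (q a : ℝ) : ℝ := a ^ q + 3 * ((1 - a) / 3) ^ q

/-- The sum of a quadratic polynomial over the entries depends only on the total and the 2-norm. The
bounding parabola touches the power at both values taken by the peaked vector, so equality holds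
there. -/
theorem sum_rpow_le_peakedPowSum {ι : Type*} [Fintype ι] (hι : Fintype.card ι = 4) {p : ι → ℝ}
    (hp : ∀ i, 0 ≤ p i) (hp1 : ∑ i, p i = 1) {q r : ℝ} (hq : 2 ≤ q) (hr0 : 0 ≤ r) (hr1 : r ≤ 1)
    (hr : ∑ i, p i ^ 2 = (1 + 3 * r ^ 2) / 4) :
    ∑ i, p i ^ q ≤ peakedPowSum q ((1 + 3 * r) / 4) := by
  have hb : (1 - (1 + 3 * r) / 4) / 3 = (1 - r) / 4 := by ring
  rw [peakedPowSum, hb]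
  -- Measuring from the small peaked value gives the total deviation `r ^ 2`, so no entry exceeds
  -- `(1 - r) / 4 + r`, the end of the parabola's range.
  have hdist : ∑ i, (p i - (1 - r) / 4) ^ 2 = r ^ 2 := by
    have : ∀ i, (p i - (1 - r) / 4) ^ 2 = p i ^ 2 - (1 - r) / 2 * p i + ((1 - r) / 4) ^ 2 :=
      fun i => by ring
    simp only [this]
    rw [Finset.sum_add_distrib, Finset.sum_sub_distrib, ← Finset.mul_sum, hr, hp1]
    simp [hι]
    ring
  have hle : ∀ i, p i ≤ (1 + 3 * r) / 4 := by
    intro i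
    have h1 : (p i - (1 - r) / 4) ^ 2 ≤ r ^ 2 := hdist ▸
      Finset.single_le_sum (f := fun i => (p i - (1 - r) / 4) ^ 2) (fun j _ => sq_nonneg _)
        (Finset.mem_univ i)
    linarith [le_of_sq_le_sq h1 hr0]
  rcases hr0.eq_or_lt with rfl | hr0
  · have : ∀ i, p i ^ q ≤ (1 / 4 : ℝ) ^ q := fun i =>
      Real.rpow_le_rpow (hp i) (by simpa using hle i) (by linarith)
    refine (Finset.sum_le_sum fun i _ => this i).trans ?_
    simp [hι]
    linarith
  obtain ⟨A, B, C, hpar, hA, hB⟩ := rpow_le_parabola (a := (1 + 3 * r) / 4) (b := (1 - r) / 4) hq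
    (by linarith) (by linarith)
  refine (Finset.sum_le_sum fun i _ => hpar (p i) (hp i) (hle i)).trans ?_
  rw [Finset.sum_add_distrib, Finset.sum_add_distrib, ← Finset.mul_sum, ← Finset.mul_sum, hr, hp1,
    hA, hB]
  simp [hι]
  linarith

theorem continuous_peakedPowSum {q : ℝ} (hq : 2 ≤ q) : Continuous (peakedPowSum q) := by
  unfold peakedPowSum
  have : ∀ f : ℝ → ℝ, Continuous f → Continuous fun x => f x ^ q := fun f hf =>
    hf.rpow_const fun _ => Or.inr (by linarith)
  exact (this _ continuous_id).add (continuous_const.mul (this _ (by fun_prop)))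

theorem strictMonoOn_peakedPowSum {q : ℝ} (hq : 2 ≤ q) :
    StrictMonoOn (peakedPowSum q) (Set.Icc (1 / 4) 1) := by
  refine strictMonoOn_of_deriv_pos (convex_Icc _ _) (continuous_peakedPowSum hq).continuousOn
    fun x hx => ?_
  rw [interior_Icc] at hx
  have h1 := Real.hasDerivAt_rpow_const (x := x) (p := q) (Or.inr (by linarith))
  have h2 : HasDerivAt (fun y : ℝ => (1 - y) / 3) (-1 / 3) x :=
    ((hasDerivAt_id x).const_sub 1).div_const 3
  have h3 := h1.add ((h2.rpow_const (p := q) (Or.inr (by linarith))).const_mul 3)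
  have h4 : deriv (peakedPowSum q) x = _ := h3.deriv
  rw [h4]
  have h5 : ((1 - x) / 3) ^ (q - 1) < x ^ (q - 1) :=
    Real.rpow_lt_rpow (by linarith [hx.2]) (by linarith [hx.1]) (by linarith)
  have h6 : 0 < q * (x ^ (q - 1) - ((1 - x) / 3) ^ (q - 1)) := mul_pos (by linarith) (by linarith)
  linarith

theorem peakedPowSum_one {q : ℝ} (hq : 2 ≤ q) : peakedPowSum q 1 = 1 := by
  simp [peakedPowSum, Real.zero_rpow (show q ≠ 0 by linarith)]

theorem sum_rpow_le_one {ι : Type*} [Fintype ι] {p : ι → ℝ} (hp : ∀ i, 0 ≤ p i)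
    (hp1 : ∑ i, p i = 1) {q : ℝ} (hq : 2 ≤ q) : ∑ i, p i ^ q ≤ 1 := by
  rw [← hp1]
  refine Finset.sum_le_sum fun i _ => ?_
  have hi : p i ≤ 1 := hp1 ▸ Finset.single_le_sum (fun j _ => hp j) (Finset.mem_univ i)
  simpa using Real.rpow_le_rpow_of_exponent_ge' (hp i) hi zero_le_one (show (1 : ℝ) ≤ q by linarith)

theorem peakedPowSum_quarter_le_sum_rpow {ι : Type*} [Fintype ι] (hι : Fintype.card ι = 4)
    {p : ι → ℝ} (hp : ∀ i, 0 ≤ p i) (hp1 : ∑ i, p i = 1) {q : ℝ} (hq : 2 ≤ q) :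
    peakedPowSum q (1 / 4) ≤ ∑ i, p i ^ q := by
  have h := Real.rpow_arith_mean_le_arith_mean_rpow Finset.univ (fun _ : ι => (1 / 4 : ℝ)) p
    (fun _ _ => by norm_num) (by simp [hι]) (fun i _ => hp i) (show 1 ≤ q by linarith)
  rw [← Finset.mul_sum, ← Finset.mul_sum, hp1, mul_one] at h
  have h3 : (1 - 1 / 4 : ℝ) / 3 = 1 / 4 := by norm_num
  rw [peakedPowSum, h3]
  linarith

/-- Every probability vector on four points has the 2-norm of a peaked one. -/
theorem exists_sum_sq_eq {ι : Type*} [Fintype ι] (hι : Fintype.card ι = 4) {p : ι → ℝ}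
    (hp : ∀ i, 0 ≤ p i) (hp1 : ∑ i, p i = 1) :
    ∃ r : ℝ, 0 ≤ r ∧ r ≤ 1 ∧ ∑ i, p i ^ 2 = (1 + 3 * r ^ 2) / 4 := by
  have h1 := sum_rpow_le_one hp hp1 le_rfl
  have h2 := peakedPowSum_quarter_le_sum_rpow hι hp hp1 le_rfl
  simp only [peakedPowSum, Real.rpow_two] at h1 h2
  norm_num at h2
  refine ⟨√((4 * ∑ i, p i ^ 2 - 1) / 3), Real.sqrt_nonneg _, ?_, ?_⟩
  · exact Real.sqrt_le_iff.mpr ⟨zero_le_one, by linarith⟩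
  · rw [Real.sq_sqrt (by linarith)]
    ring

/-! ### The family `ψ_t` -/

theorem psiVec_apply (t : ℝ) (x : Fin 2 × Fin 2) :
    psiVec t x = (((if x = (0, 0) then t else 1) / √(3 + t ^ 2) : ℝ) : ℂ) := by
  obtain ⟨i, j⟩ := x
  fin_cases i <;> fin_cases j <;> simp [psiVec, ket, div_eq_inv_mul]

theorem psi_op_apply (t : ℝ) (x y : Fin 2 × Fin 2) :
    (psi t).op x y = (((if x = (0, 0) then t else 1) * (if y = (0, 0) then t else 1)
      / (3 + t ^ 2) : ℝ) : ℂ) := by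
  have h : √(3 + t ^ 2) * √(3 + t ^ 2) = 3 + t ^ 2 := Real.mul_self_sqrt (by positivity)
  simp only [psi, pureState, vecMulVec_apply, Pi.star_apply, psiVec_apply]
  rw [Complex.star_def, Complex.conj_ofReal, ← Complex.ofReal_mul, div_mul_div_comm, h]

theorem psi_op_re (t : ℝ) (x y : Fin 2 × Fin 2) :
    ((psi t).op x y).re = (if x = (0, 0) then t else 1) * (if y = (0, 0) then t else 1)
      / (3 + t ^ 2) := by
  rw [psi_op_apply, Complex.ofReal_re]

theorem psiInfty_op_apply (x y : Fin 2 × Fin 2) :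
    psiInfty.op x y = if x = (0, 0) ∧ y = (0, 0) then 1 else 0 := by
  simp only [psiInfty, pureState, vecMulVec_apply, Pi.star_apply, ket, Pi.single_apply]
  by_cases hx : x = (0, 0) <;> by_cases hy : y = (0, 0) <;> simp [hx, hy]

/-- The largest outcome probability of `σ_z ⊗ σ_z` in the state `ψ_t`. -/
noncomputable def peakZ (t : ℝ) : ℝ := t ^ 2 / (3 + t ^ 2)

/-- The largest outcome probability of `σ_x ⊗ σ_x` in the state `ψ_t`. -/
noncomputable def peakX (t : ℝ) : ℝ := (t + 3) ^ 2 / (4 * (3 + t ^ 2))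

theorem sum_outcomeProb_sigmaZ_psi (q t : ℝ) :
    ∑ j, outcomeProb sigmaZ (psi t) j ^ q = peakedPowSum q (peakZ t) := by
  have h : 3 + t ^ 2 ≠ 0 := by positivity
  have h1 : (1 - peakZ t) / 3 = (3 + t ^ 2)⁻¹ := by
    rw [peakZ]; field_simp; ring
  simp only [Fintype.sum_prod_type, Fin.sum_univ_two, outcomeProb_sigmaZ, psi_op_re,
    peakedPowSum, h1]
  simp [peakZ, ← sq]
  ring

theorem sum_outcomeProb_sigmaX_psi (q t : ℝ) :
    ∑ j, outcomeProb sigmaX (psi t) j ^ q = peakedPowSum q (peakX t) := by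
  have h : 3 + t ^ 2 ≠ 0 := by positivity
  have h1 : (1 - peakX t) / 3 = (t - 1) ^ 2 / (4 * (3 + t ^ 2)) := by
    rw [peakX]; field_simp; ring
  have e00 : outcomeProb sigmaX (psi t) (0, 0) = peakX t := by
    simp [outcomeProb_sigmaX, psi_op_re, peakX, Fin.sum_univ_two]
    field_simp; ring
  have e01 : outcomeProb sigmaX (psi t) (0, 1) = (t - 1) ^ 2 / (4 * (3 + t ^ 2)) := by
    simp [outcomeProb_sigmaX, psi_op_re, Fin.sum_univ_two]
    field_simp; ring
  have e10 : outcomeProb sigmaX (psi t) (1, 0) = (t - 1) ^ 2 / (4 * (3 + t ^ 2)) := by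
    simp [outcomeProb_sigmaX, psi_op_re, Fin.sum_univ_two]
    field_simp; ring
  have e11 : outcomeProb sigmaX (psi t) (1, 1) = (t - 1) ^ 2 / (4 * (3 + t ^ 2)) := by
    simp [outcomeProb_sigmaX, psi_op_re, Fin.sum_univ_two]
    field_simp; ring
  simp only [Fintype.sum_prod_type, Fin.sum_univ_two, e00, e01, e10, e11, peakedPowSum, h1]
  ring

theorem sum_outcomeProb_sigmaZ_psiInfty {q : ℝ} (hq : 2 ≤ q) :
    ∑ j, outcomeProb sigmaZ psiInfty j ^ q = 1 := by
  simp [Fintype.sum_prod_type, outcomeProb_sigmaZ, psiInfty_op_apply,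
    Real.zero_rpow (show q ≠ 0 by linarith)]

theorem sum_outcomeProb_sigmaX_psiInfty (q : ℝ) :
    ∑ j, outcomeProb sigmaX psiInfty j ^ q = peakedPowSum q (1 / 4) := by
  have h3 : (1 - 1 / 4 : ℝ) / 3 = 1 / 4 := by norm_num
  have h : ∀ j, outcomeProb sigmaX psiInfty j = 1 / 4 := by
    rintro ⟨i, j⟩
    simp [outcomeProb_sigmaX, psiInfty_op_apply, Fin.sum_univ_two]
  simp only [h, peakedPowSum, h3]
  simp
  ring

theorem tendsto_one_div_three_add_sq :
    Filter.Tendsto (fun t : ℝ => 1 / (3 + t ^ 2)) Filter.atTop (nhds 0) :=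
  tendsto_const_nhds.div_atTop
    (Filter.tendsto_atTop_add_const_left _ _ (Filter.tendsto_pow_atTop two_ne_zero))

theorem tendsto_div_three_add_sq :
    Filter.Tendsto (fun t : ℝ => t / (3 + t ^ 2)) Filter.atTop (nhds 0) := by
  refine squeeze_zero' ?_ ?_ tendsto_inv_atTop_zero
  · filter_upwards [Filter.eventually_ge_atTop 0] with t ht
    positivity
  · filter_upwards [Filter.eventually_gt_atTop 0] with t ht
    rw [div_le_iff₀ (by positivity)]
    field_simp
    linarith

theorem tendsto_psi_op :
    Filter.Tendsto (fun t : ℝ => (psi t).op) Filter.atTop (nhds psiInfty.op) := by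
  have h0 := tendsto_one_div_three_add_sq
  have h1 := tendsto_div_three_add_sq
  have h2 : Filter.Tendsto (fun t : ℝ => t * t / (3 + t ^ 2)) Filter.atTop (nhds 1) := by
    have : (fun t : ℝ => t * t / (3 + t ^ 2)) = fun t => 1 - 3 * (1 / (3 + t ^ 2)) := by
      ext t
      have : 3 + t ^ 2 ≠ 0 := by positivity
      field_simp
      ring
    rw [this]
    simpa using (tendsto_const_nhds (x := (1 : ℝ))).sub (h0.const_mul 3)
  refine tendsto_pi_nhds.mpr fun x => tendsto_pi_nhds.mpr fun y => ?_
  simp only [psi_op_apply, psiInfty_op_apply]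
  by_cases hx : x = (0, 0) <;> by_cases hy : y = (0, 0)
  · simpa only [Function.comp_def, hx, hy, and_self, if_true, Complex.ofReal_one] using
      (Complex.continuous_ofReal.tendsto _).comp h2
  · simpa only [Function.comp_def, hx, hy, and_false, if_true, if_false, mul_one,
      Complex.ofReal_zero] using
      (Complex.continuous_ofReal.tendsto _).comp h1
  · simpa only [Function.comp_def, hx, hy, false_and, if_true, if_false, one_mul,
      Complex.ofReal_zero] using
      (Complex.continuous_ofReal.tendsto _).comp h1
  · simpa only [Function.comp_def, hx, hy, and_self, if_false, one_mul, Complex.ofReal_zero] using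
      (Complex.continuous_ofReal.tendsto _).comp h0

theorem peakX_one : peakX 1 = 1 := by norm_num [peakX]

theorem strictAntiOn_peakX : StrictAntiOn peakX (Set.Ici 1) := by
  intro s hs t ht hst
  rw [Set.mem_Ici] at hs ht
  rw [peakX, peakX, div_lt_div_iff₀ (by positivity) (by positivity)]
  -- Up to a positive constant, this is the difference of the cross-multiplied sides.
  have h : 0 < (t - s) * (s * t + s + t - 3) := mul_pos (by linarith) (by nlinarith)
  nlinarith

theorem quarter_lt_peakX {t : ℝ} (ht : 1 ≤ t) : 1 / 4 < peakX t := by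
  rw [peakX, lt_div_iff₀ (by positivity)]
  nlinarith

theorem peakX_mem_Icc {t : ℝ} (ht : 1 ≤ t) : peakX t ∈ Set.Icc (1 / 4) 1 :=
  ⟨(quarter_lt_peakX ht).le, peakX_one ▸ strictAntiOn_peakX.antitoneOn Set.self_mem_Ici ht ht⟩

theorem peakZ_mem_Icc {t : ℝ} (ht : 1 ≤ t) : peakZ t ∈ Set.Icc (1 / 4) 1 := by
  constructor
  · rw [peakZ, le_div_iff₀ (by positivity)]
    nlinarith
  · rw [peakZ, div_le_one (by positivity)]
    linarith

theorem continuous_peakX : Continuous peakX := by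
  unfold peakX
  exact Continuous.div (by fun_prop) (by fun_prop) fun t => by positivity

theorem tendsto_peakX : Filter.Tendsto peakX Filter.atTop (nhds (1 / 4)) := by
  have h : ∀ t, peakX t = 1 / 4 + (3 / 2 * (t / (3 + t ^ 2)) + 3 / 2 * (1 / (3 + t ^ 2))) := by
    intro t
    have : 3 + t ^ 2 ≠ 0 := by positivity
    simp only [peakX]
    field_simp
    ring
  rw [funext h]
  simpa only [mul_zero, add_zero] using ((tendsto_div_three_add_sq.const_mul (3 / 2)).add
    (tendsto_one_div_three_add_sq.const_mul (3 / 2))).const_add (1 / 4)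

theorem strictAntiOn_peakedPowSum_peakX {q : ℝ} (hq : 2 ≤ q) :
    StrictAntiOn (fun t => peakedPowSum q (peakX t)) (Set.Ici 1) := fun _ hs _ ht hst =>
  strictMonoOn_peakedPowSum hq (peakX_mem_Icc ht) (peakX_mem_Icc hs) (strictAntiOn_peakX hs ht hst)

theorem exists_peakedPowSum_peakX_eq {q y : ℝ} (hq : 2 ≤ q) (hy : peakedPowSum q (1 / 4) < y)
    (hy1 : y ≤ 1) : ∃ t, 1 ≤ t ∧ peakedPowSum q (peakX t) = y := by
  have hlim := ((continuous_peakedPowSum hq).tendsto _).comp tendsto_peakX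
  obtain ⟨T, hTy, hT⟩ := ((hlim.eventually_lt_const hy).and (Filter.eventually_ge_atTop 1)).exists
  have hivt := intermediate_value_Icc' hT
    ((continuous_peakedPowSum hq).comp continuous_peakX).continuousOn
  obtain ⟨t, ht, hty⟩ := hivt ⟨hTy.le, by simpa [peakX_one, peakedPowSum_one hq] using hy1⟩
  exact ⟨t, ht.1, hty⟩

/-! ### Optimality of `ψ_t` -/

/-- The `σ_x` hypothesis forces `(1 + 3w)/4 ≥ peakX t`; the linear bound tight at `ψ_t` turns this
into `(1 + 3r)/4 ≤ peakZ t`. -/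
theorem sum_outcomeProb_sigmaZ_le {q q' : ℝ} (hq : 2 ≤ q) (hq' : 2 ≤ q') (ρ : TwoQubitState)
    {t : ℝ} (ht : 1 ≤ t)
    (h : peakedPowSum q' (peakX t) ≤ ∑ j, outcomeProb sigmaX ρ j ^ q') :
    ∑ j, outcomeProb sigmaZ ρ j ^ q ≤ peakedPowSum q (peakZ t) := by
  have hcard : Fintype.card (Fin 2 × Fin 2) = 4 := rfl
  have nZ := outcomeProb_nonneg sigmaZ_isHermitian sigmaZ_mul_self ρ
  have nX := outcomeProb_nonneg sigmaX_isHermitian sigmaX_mul_self ρ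
  have sZ := sum_outcomeProb sigmaZ ρ
  have sX := sum_outcomeProb sigmaX ρ
  obtain ⟨r, hr0, hr1, hr⟩ := exists_sum_sq_eq hcard nZ sZ
  obtain ⟨w, hw0, hw1, hw⟩ := exists_sum_sq_eq hcard nX sX
  have hX : peakX t ≤ (1 + 3 * w) / 4 :=
    ((strictMonoOn_peakedPowSum hq').le_iff_le (peakX_mem_Icc ht)
      ⟨by linarith, by linarith⟩).mp
      (h.trans (sum_rpow_le_peakedPowSum hcard nX sX hq' hw0 hw1 hw))
  -- A rational parametrisation of `3ab = 4(a+b-1)`, chosen so that `ψ_s` attains equality.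
  have hunc : ∀ s : ℝ, 1 ≤ s →
      (s - 1) / s * (1 + 3 * r) + 4 / (s + 3) * (1 + 3 * w) ≤ 4 := by
    intro s hs
    have hs0 : 0 < s := by linarith
    refine uncertainty_relation ρ hr hw (div_nonneg (by linarith) hs0.le) (by positivity) ?_ ?_
    · rw [div_add_div _ _ (by positivity) (by positivity), div_le_iff₀ (by positivity)]
      nlinarith
    · field_simp
      ring
  have hZ : (1 + 3 * r) / 4 ≤ peakZ t := by
    rcases ht.eq_or_lt with rfl | ht1
    · rw [peakX_one] at hX
      have hw' : w = 1 := by linarith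
      -- At `t = 1` the coefficient of `r` vanishes and the bound says nothing about `r`. Instead
      -- the bounds for `s > 1` are divided by `s - 1`, and `s → 1` gives `r ≤ 0`.
      subst hw'
      have hs : ∀ s : ℝ, 1 < s → (1 + 3 * r) * (s + 3) ≤ 4 * s := by
        intro s hs
        have hs0 : 0 < s := by linarith
        have h1 := hunc s hs.le
        rw [div_mul_eq_mul_div, div_mul_eq_mul_div, div_add_div _ _ (by positivity) (by positivity),
          div_le_iff₀ (by positivity)] at h1
        have : (s - 1) * ((1 + 3 * r) * (s + 3)) ≤ (s - 1) * (4 * s) := by linarith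
        exact le_of_mul_le_mul_left this (by linarith)
      have hr' : r ≤ 0 := by
        refine le_of_forall_pos_le_add fun ε hε => ?_
        nlinarith [hs (1 + ε) (by linarith)]
      norm_num [peakZ]
      linarith
    · have ht0 : 0 < t := by linarith
      have h1 := hunc t ht
      have h2 : 4 / (t + 3) * (4 * peakX t) ≤ 4 / (t + 3) * (1 + 3 * w) :=
        mul_le_mul_of_nonneg_left (by linarith) (by positivity)
      have h3 : (t - 1) / t * (4 * peakZ t) + 4 / (t + 3) * (4 * peakX t) = 4 := by
        rw [peakZ, peakX]
        field_simp
        ring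
      have h4 : (t - 1) / t * (1 + 3 * r) ≤ (t - 1) / t * (4 * peakZ t) := by linarith
      have := le_of_mul_le_mul_left h4 (div_pos (by linarith) ht0)
      linarith
  exact (sum_rpow_le_peakedPowSum hcard nZ sZ hq hr0 hr1 hr).trans
    ((strictMonoOn_peakedPowSum hq).monotoneOn ⟨by linarith, by linarith⟩ (peakZ_mem_Icc ht) hZ)

theorem tsallis_le_iff {ι κ : Type*} [Fintype ι] [Fintype κ] {q : ℝ} (hq : 2 ≤ q) (p : ι → ℝ)
    (p' : κ → ℝ) : tsallis q p ≤ tsallis q p' ↔ ∑ j, p' j ^ q ≤ ∑ j, p j ^ q := by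
  have : 0 < 1 / (q - 1) := by
    have : 0 < q - 1 := by linarith
    positivity
  rw [tsallis, tsallis, mul_le_mul_iff_right₀ this, sub_le_sub_iff_left]

theorem tsallis_eq_iff {ι κ : Type*} [Fintype ι] [Fintype κ] {q : ℝ} (hq : 2 ≤ q) (p : ι → ℝ)
    (p' : κ → ℝ) : tsallis q p = tsallis q p' ↔ ∑ j, p j ^ q = ∑ j, p' j ^ q := by
  rw [le_antisymm_iff, tsallis_le_iff hq, tsallis_le_iff hq, le_antisymm_iff, and_comm]

/-- The cases are whether the `σ_x` power sum exceeds its minimum `peakedPowSum q' (1/4)`. If so,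
the intermediate value theorem and monotonicity yield the unique `t`. At the minimum no finite `t`
qualifies, since `peakX t > 1/4`, while `|00⟩` has the maximal `σ_z` power sum 1. -/
theorem psi_optimal {q q' : ℝ} (hq : 2 ≤ q) (hq' : 2 ≤ q') (ρ : TwoQubitState) :
    (Sxx q' ρ < Sxx q' psiInfty ∧
      (∃! t : ℝ, 1 ≤ t ∧ Sxx q' (psi t) = Sxx q' ρ) ∧
      ∀ t : ℝ, 1 ≤ t → Sxx q' (psi t) = Sxx q' ρ → Szz q (psi t) ≤ Szz q ρ) ∨
    (Sxx q' ρ = Sxx q' psiInfty ∧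
      (∀ t : ℝ, 1 ≤ t → Sxx q' (psi t) ≠ Sxx q' ρ) ∧
      Szz q psiInfty ≤ Szz q ρ) := by
  have hcard : Fintype.card (Fin 2 × Fin 2) = 4 := rfl
  have nZ := outcomeProb_nonneg sigmaZ_isHermitian sigmaZ_mul_self ρ
  have nX := outcomeProb_nonneg sigmaX_isHermitian sigmaX_mul_self ρ
  have sZ := sum_outcomeProb sigmaZ ρ
  have sX := sum_outcomeProb sigmaX ρ
  have hmin := peakedPowSum_quarter_le_sum_rpow hcard nX sX hq'
  simp only [Sxx, Szz, ← not_le, tsallis_le_iff hq, tsallis_le_iff hq', tsallis_eq_iff hq', ne_eq,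
    sum_outcomeProb_sigmaZ_psi, sum_outcomeProb_sigmaX_psi, sum_outcomeProb_sigmaX_psiInfty,
    sum_outcomeProb_sigmaZ_psiInfty hq]
  rcases hmin.eq_or_lt with heq | hlt
  · refine Or.inr ⟨heq.symm, fun t ht h => ?_, sum_rpow_le_one nZ sZ hq⟩
    rw [← heq] at h
    exact (quarter_lt_peakX ht).ne' ((strictMonoOn_peakedPowSum hq').injOn (peakX_mem_Icc ht)
      ⟨le_rfl, by norm_num⟩ h)
  · refine Or.inl ⟨hlt.not_ge, ?_, fun t ht h => sum_outcomeProb_sigmaZ_le hq hq' ρ ht h.le⟩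
    obtain ⟨t, ht, hty⟩ := exists_peakedPowSum_peakX_eq hq' hlt (sum_rpow_le_one nX sX hq')
    exact ⟨t, ⟨ht, hty⟩, fun s hs =>
      (strictAntiOn_peakedPowSum_peakX hq').injOn hs.1 ht (hs.2.trans hty.symm)⟩

end ScrambledQubits

open ScrambledQubits in
theorem theorem1 (q q' : ℝ) (hq : 2 ≤ q) (hq' : 2 ≤ q') :
    -- the lower boundary is the curve of the states `ψ_t`, `1 ≤ t`, with its endpoint `t = ∞`
    lowerBoundary (entropyRegion q' q) =
        (fun t : ℝ => entropyPoint q' q (psi t)) '' Set.Ici 1 ∪ {entropyPoint q' q psiInfty} ∧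
    Filter.Tendsto (fun t : ℝ => (psi t).op) Filter.atTop (nhds psiInfty.op) ∧
    -- every value of `S_xx` is attained by exactly one member of the family, and this member
    -- has the least `S_zz` among all states with this value of `S_xx`
    ∀ ρ : TwoQubitState,
      (Sxx q' ρ < Sxx q' psiInfty ∧
        (∃! t : ℝ, 1 ≤ t ∧ Sxx q' (psi t) = Sxx q' ρ) ∧
        ∀ t : ℝ, 1 ≤ t → Sxx q' (psi t) = Sxx q' ρ → Szz q (psi t) ≤ Szz q ρ) ∨
      (Sxx q' ρ = Sxx q' psiInfty ∧
        (∀ t : ℝ, 1 ≤ t → Sxx q' (psi t) ≠ Sxx q' ρ) ∧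
        Szz q psiInfty ≤ Szz q ρ) := by
  refine ⟨?_, tendsto_psi_op, psi_optimal hq hq'⟩
  ext P
  constructor
  · rintro ⟨⟨ρ, rfl⟩, hP⟩
    rcases psi_optimal hq hq' ρ with ⟨-, ⟨t, ⟨ht, htx⟩, -⟩, hle⟩ | ⟨hx, -, hle⟩
    · exact Or.inl ⟨t, ht, Prod.ext htx
        (le_antisymm (hle t ht htx) (hP _ ⟨psi t, Prod.ext htx rfl⟩))⟩
    · exact Or.inr (Prod.ext hx
        (le_antisymm (hP _ ⟨psiInfty, Prod.ext hx.symm rfl⟩) hle))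
  · rintro (⟨t, ht, rfl⟩ | rfl)
    · refine ⟨⟨psi t, rfl⟩, ?_⟩
      rintro y ⟨ρ, hρ⟩
      obtain ⟨hx, rfl⟩ := Prod.ext_iff.mp hρ
      rcases psi_optimal hq hq' ρ with ⟨-, -, hle⟩ | ⟨-, hne, -⟩
      · exact hle t ht hx.symm
      · exact absurd hx.symm (hne t ht)
    · refine ⟨⟨psiInfty, rfl⟩, ?_⟩
      rintro y ⟨ρ, hρ⟩
      obtain ⟨hx, rfl⟩ := Prod.ext_iff.mp hρ
      rcases psi_optimal hq hq' ρ with ⟨hlt, -, -⟩ | ⟨-, -, hle⟩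
      · exact absurd hx hlt.ne
      · exact hle
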